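/- Let $G$ be a connected and simply connected nilpotent (real, finite-dimensional) Lie group with Lie algebra $\mathfrak g$ and exponential map $\exp:\mathfrak g\to G$, and let $N\le G$ be a lattice, that is, a discrete subgroup such that the space $N\backslash G$ of cosets $Ng$ is compact. Let $p:G\to N\backslash G$, $p(g)=Ng$, be the projection. Let $N^{\mathbb Q}$ be the radicable hull (rational Mal'cev completion) of $N$ in $G$, i.e. $N^{\mathbb Q}=\exp(\mathfrak n^{\mathbb Q})$, where $\mathfrak n^{\mathbb Q}\subseteq\mathfrak g$ is the $\mathbb Q$-linear span of $\log N=\{X\in\mathfrak g : \exp X\in N\}$. Let $\delta$ be a continuous automorphism of $G$ with $\delta(N)\subseteq N$, and let $\bar\delta:N\backslash G\to N\backslash G$, $\bar\delta(Ng)=N\delta(g)$, be the induced nilmanifold endomorphism. Then every point of $p(N^{\mathbb Q})$ is eventually periodic for $\bar\delta$: $$p(N^{\mathbb Q})\subseteq \mathrm{ePer}(\bar\delta),$$ where $\mathrm{ePer}(\bar\delta)$ is the set of points $x$ such that, for some $k>0$, the point $y=\bar\delta^{\,k}(x)$ satisfies $\bar\delta^{\,m}(y)=y$ for some $m>0$.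 -/

import Mathlib

open scoped Manifold ContDiff

/-- A lattice of a topological group `G`: a discrete subgroup `N` such that the space `N \ G` of
cosets `N g`, with the quotient topology, is compact. -/
structure IsCocompactLattice {G : Type*} [Group G] [TopologicalSpace G] (N : Subgroup G) :
    Prop where
  discrete : DiscreteTopology N
  compact : CompactSpace (Quotient (QuotientGroup.rightRel N))

/-- The space `N \ G` of cosets `N g`, carrying the quotient topology. -/
abbrev Nilmanifold {G : Type*} [Group G] (N : Subgroup G) : Type _ :=
  Quotient (QuotientGroup.rightRel N)

/-- The projection `p : G → N \ G`, `g ↦ N g`. -/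
def nilProj {G : Type*} [Group G] (N : Subgroup G) (g : G) : Nilmanifold N :=
  Quotient.mk (QuotientGroup.rightRel N) g

/-- The self-map `N g ↦ N δ(g)` of `N \ G` induced by a continuous automorphism `δ` of `G`
with `δ(N) ≤ N`. -/
def nilEndomorphism {G : Type*} [Group G] [TopologicalSpace G] (N : Subgroup G) (δ : G ≃ₜ* G)
    (hδ : ∀ n ∈ N, δ n ∈ N) : Nilmanifold N → Nilmanifold N :=
  Quotient.map δ fun a b hab => by
    have h : b * a⁻¹ ∈ N := QuotientGroup.rightRel_apply.mp hab
    exact QuotientGroup.rightRel_apply.mpr (by simpa using hδ _ h)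

/-- The eventually periodic points of `f`: the points `x` such that `f^k(x)` is periodic for some
`k > 0`. -/
def ePer {X : Type*} (f : X → X) : Set X :=
  {x | ∃ k : ℕ, 0 < k ∧ f^[k] x ∈ Function.periodicPts f}

section LieGroup

variable {E : Type*} [NormedAddCommGroup E] [NormedSpace ℝ E]
  {H : Type*} [TopologicalSpace H] (I : ModelWithCorners ℝ E H)
  {G : Type*} [Group G] [TopologicalSpace G] [ChartedSpace H G]

/-- `IsLieExp I X g` says that `exp X = g`: the integral curve through `1` of the left-invariant
vector field of `X` takes the value `g` at time `1`. -/
def IsLieExp (X : GroupLieAlgebra I G) (g : G) : Prop :=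
  ∃ γ : ℝ → G, γ 0 = 1 ∧ IsMIntegralCurve (I := I) γ (mulInvariantVectorField X) ∧ γ 1 = g

/-- The set `log N` of all vectors `X` of the Lie algebra of `G` with `exp X ∈ N`. -/
def lieLog (N : Subgroup G) : Set (GroupLieAlgebra I G) :=
  {X | ∃ n ∈ N, IsLieExp I X n}

/-- The Lie algebra of a real Lie group as a vector space over `ℚ`. -/
@[reducible]
noncomputable def lieRatModule (G : Type*) [Group G] [TopologicalSpace G] [ChartedSpace H G] :
    Module ℚ (GroupLieAlgebra I G) :=
  Module.compHom _ (algebraMap ℚ ℝ)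

/-- The rational subspace of the Lie algebra of `G` spanned by `log N`. -/
noncomputable def rationalLieAlgebra (N : Subgroup G) : Set (GroupLieAlgebra I G) :=
  letI := lieRatModule I G
  (Submodule.span ℚ (lieLog I N) : Submodule ℚ (GroupLieAlgebra I G))

/-- The radicable hull (rational Mal'cev completion) `N^ℚ` of `N` in `G`: the image under `exp` of
the rational subspace spanned by `log N`. -/
def radicableHull (N : Subgroup G) : Set G :=
  {g | ∃ X ∈ rationalLieAlgebra I N, IsLieExp I X g}

end LieGroup

/-!
Consider the pairs `(a, b)` with `b = a ^ m` modulo commutators. On the `k`-th term of the lower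
central series of a group of such pairs (counting from `k = 0`) one has `b = a ^ m ^ (k + 1)` modulo
the next term: iterated commutators are homogeneous. By descent along the lower central series of a
nilpotent group, the subgroup generated by elements with `m`-th powers in `K` has a uniform exponent
`M` that takes it into `K`. In particular, the elements with a positive power in `K` form a
subgroup, the isolator of `K`.

If `x` and `y` are one-parameter subgroups with values in the isolator of `N`, then so is the one
with velocity `X + Y`: as the error of `x t * y t` is homogeneous in `t` at each level of the lower
central series, Richardson extrapolation removes it with finitely many products, powers and
inverses, all of which stay in the isolator at rational times. This replaces the
Baker–Campbell–Hausdorff formula and shows that `N^ℚ` is contained in the isolator of `N`.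

Finally let `g ^ m ∈ N`. The subgroup generated by all `m`-th roots of elements of `N` is taken into
`N` by some `u ↦ u ^ M`, which is injective near `1`; so it is discrete, as `N` is, and has finite
image in the compact space `N \ G`. The classes of these roots thus form a finite set, which
contains the class of `g` and is invariant under the induced map.
-/

section NilpotentGroups

open Subgroup
open scoped commutatorElement IsMulCommutative

variable {H D : Type*} [Group H] [Group D]

local notation "Γ[" H "][" k "]" => Subgroup.lowerCentralSeries (⊤ : Subgroup H) k

theorem map_mem_lowerCentralSeries (f : D →* H) {k : ℕ} {d : D} (hd : d ∈ Γ[D][k]) :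
    f d ∈ Γ[H][k] :=
  lowerCentralSeries_mono k le_top
    (map_lowerCentralSeries (S := ⊤) f k ▸ mem_map_of_mem f hd)

theorem mk_mem_center_of_mem_lowerCentralSeries {k : ℕ} {z : H} (hz : z ∈ Γ[H][k]) :
    (z : H ⧸ Γ[H][k + 1]) ∈ center (H ⧸ Γ[H][k + 1]) := by
  refine mem_center_iff.mpr fun q => ?_
  induction q using QuotientGroup.induction_on with | H h =>
  have hcomm : ⁅z, h⁆ ∈ Γ[H][k + 1] := commutator_mem_commutator hz (mem_top h)
  exact (commutatorElement_eq_one_iff_mul_comm.mp ((QuotientGroup.eq_one_iff _).mpr hcomm)).symm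

/-- The homomorphism `b ↦ ⁅a, b⁆`, for an element `a` all of whose commutators are central. -/
def commutatorHom (a : H) (ha : ∀ b, ⁅a, b⁆ ∈ center H) : H →* center H :=
  MonoidHom.mk' (fun b => ⟨⁅a, b⁆, ha b⟩) fun b c => Subtype.ext <| by
    change ⁅a, b * c⁆ = ⁅a, b⁆ * ⁅a, c⁆
    rw [commutatorElement_mul_right_eq_mul_conj, mul_assoc ⁅a, b⁆, mem_center_iff.mp (ha c),
      mul_assoc, mul_inv_cancel_right]

theorem commutatorElement_mul_left_of_mem_center {a b c : H} (h : ⁅b, c⁆ ∈ center H) :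
    ⁅a * b, c⁆ = ⁅a, c⁆ * ⁅b, c⁆ := by
  rw [commutatorElement_mul_left_eq_conj_mul, mem_center_iff.mp h, mul_inv_cancel_right,
    mem_center_iff.mp h]

theorem commutatorElement_pow_left_of_mem_center {a b : H} (h : ⁅a, b⁆ ∈ center H) (i : ℕ) :
    ⁅a ^ i, b⁆ = ⁅a, b⁆ ^ i := by
  induction i with
  | zero => simp only [pow_zero, commutatorElement_one_left]
  | succ i ih => rw [pow_succ, commutatorElement_mul_left_of_mem_center h, ih, pow_succ]

theorem commutatorElement_pow_mul_pow_mul {a b u v : H} (ha : ∀ c, ⁅a, c⁆ ∈ center H)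
    (hu : u ∈ center H) (hv : v ∈ commutator H) (i j : ℕ) :
    ⁅a ^ i * u, b ^ j * v⁆ = ⁅a, b⁆ ^ (i * j) := by
  have hu_comm (c : H) : ⁅u, c⁆ = 1 :=
    commutatorElement_eq_one_iff_mul_comm.mpr (mem_center_iff.mp hu c).symm
  have ha_comm : ⁅a, b ^ j * v⁆ = ⁅a, b⁆ ^ j := by
    have hker : commutator H ≤ (commutatorHom a ha).ker := Abelianization.commutator_subset_ker _
    have h : commutatorHom a ha (b ^ j * v) = commutatorHom a ha b ^ j := by
      rw [map_mul, map_pow, MonoidHom.mem_ker.mp (hker hv), mul_one]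
    exact congrArg Subtype.val h
  rw [commutatorElement_mul_left_of_mem_center (hu_comm _ ▸ one_mem _), hu_comm, mul_one,
    commutatorElement_pow_left_of_mem_center (ha _), ha_comm, ← pow_mul, mul_comm]

theorem mk_commutatorElement_eq_mk_pow {a a' b b' : H} {k i j : ℕ} (ha : a ∈ Γ[H][k])
    (haa' : (a' : H ⧸ Γ[H][k + 1]) = (a : H ⧸ Γ[H][k + 1]) ^ i)
    (hbb' : Abelianization.of b' = Abelianization.of b ^ j) :
    ((⁅a', b'⁆ : H) : H ⧸ Γ[H][k + 2]) = ((⁅a, b⁆ : H) : H ⧸ Γ[H][k + 2]) ^ (i * j) := by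
  let π := QuotientGroup.mk' Γ[H][k + 2]
  have hu : π ((a ^ i)⁻¹ * a') ∈ center _ :=
    mk_mem_center_of_mem_lowerCentralSeries (QuotientGroup.eq.mp haa'.symm)
  have hv : π ((b ^ j)⁻¹ * b') ∈ commutator _ := by
    rw [← top_lowerCentralSeries_one]
    refine map_mem_lowerCentralSeries π ?_
    rw [top_lowerCentralSeries_one]
    exact QuotientGroup.eq.mp ((map_pow _ _ _).trans hbb'.symm)
  have hcentral (q : H ⧸ Γ[H][k + 2]) : ⁅π a, q⁆ ∈ center _ := by
    induction q using QuotientGroup.induction_on with | H c =>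
    exact map_commutatorElement π a c ▸
      mk_mem_center_of_mem_lowerCentralSeries (commutator_mem_commutator ha (mem_top c))
  have h := commutatorElement_pow_mul_pow_mul (b := π b) hcentral hu hv i j
  rw [← map_pow, ← map_pow, ← map_mul, ← map_mul, mul_inv_cancel_left, mul_inv_cancel_left,
    ← map_commutatorElement, ← map_commutatorElement] at h
  exact h

theorem mk_eq_mk_pow_of_mem_lowerCentralSeries {f g : D →* H} {l : ℕ}
    (hfg : ∀ d, Abelianization.of (g d) = Abelianization.of (f d) ^ l) {k : ℕ} {d : D}
    (hd : d ∈ Γ[D][k]) : (g d : H ⧸ Γ[H][k + 1]) = (f d : H ⧸ Γ[H][k + 1]) ^ l ^ (k + 1) := by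
  induction k generalizing d with
  | zero =>
    have h : (f d ^ l)⁻¹ * g d ∈ Γ[H][1] := by
      rw [top_lowerCentralSeries_one]
      exact QuotientGroup.eq.mp ((map_pow _ _ _).trans (hfg d).symm)
    rw [zero_add, pow_one]
    exact (QuotientGroup.eq.mpr h).symm
  | succ k ih =>
    rw [Subgroup.lowerCentralSeries_succ, Subgroup.commutator_def] at hd
    induction hd using closure_induction with
    | mem x hx =>
      obtain ⟨p, hp, q, -, rfl⟩ := hx
      rw [map_commutatorElement, map_commutatorElement, pow_succ l]
      exact mk_commutatorElement_eq_mk_pow (map_mem_lowerCentralSeries f hp) (ih hp) (hfg q)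
    | one => simp only [map_one, QuotientGroup.mk_one, one_pow]
    | mul x y hx _ ihx ihy =>
      have hcomm : Commute (f x : H ⧸ Γ[H][k + 2]) (f y) := (mem_center_iff.mp
        (mk_mem_center_of_mem_lowerCentralSeries (map_mem_lowerCentralSeries f hx)) _).symm
      rw [map_mul, map_mul, QuotientGroup.mk_mul, QuotientGroup.mk_mul, ihx, ihy, hcomm.mul_pow]
    | inv x _ ihx =>
      rw [map_inv, map_inv, QuotientGroup.mk_inv, QuotientGroup.mk_inv, ihx, inv_pow]

/-- The subgroup of all pairs `(a, b)` with `b = a ^ m` modulo commutators. It contains the graph of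
the `m`-th power map, which need not be a homomorphism. -/
def powerRelation (H : Type*) [Group H] (m : ℕ) : Subgroup (H × H) :=
  MonoidHom.eqLocus (Abelianization.of.comp (MonoidHom.snd H H))
    ((powMonoidHom m).comp (Abelianization.of.comp (MonoidHom.fst H H)))

theorem mem_powerRelation {m : ℕ} {p : H × H} :
    p ∈ powerRelation H m ↔ Abelianization.of p.2 = Abelianization.of p.1 ^ m :=
  Iff.rfl

theorem mk_pow_mem_powerRelation (m : ℕ) (h : H) : (h, h ^ m) ∈ powerRelation H m :=
  mem_powerRelation.mpr (map_pow _ _ _)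

theorem mk_snd_eq_mk_fst_pow_of_mem_lowerCentralSeries {m k : ℕ} {D : Subgroup (H × H)}
    (hD : D ≤ powerRelation H m) {d : D} (hd : d ∈ Γ[D][k]) :
    (d.1.2 : H ⧸ Γ[H][k + 1]) = (d.1.1 : H ⧸ Γ[H][k + 1]) ^ m ^ (k + 1) :=
  mk_eq_mk_pow_of_mem_lowerCentralSeries (f := (MonoidHom.fst H H).comp D.subtype)
    (g := (MonoidHom.snd H H).comp D.subtype) (fun d => mem_powerRelation.mp (hD d.2)) hd

theorem pow_mem_sup_lowerCentralSeries_succ {S : Set H} (hS : closure S = ⊤) {K : Subgroup H}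
    {m : ℕ} (hm : ∀ s ∈ S, s ^ m ∈ K) {k : ℕ} {u : H} (hu : u ∈ Γ[H][k]) :
    u ^ m ^ (k + 1) ∈ K ⊔ Γ[H][k + 1] := by
  let D : Subgroup (H × H) := powerRelation H m ⊓ K.comap (MonoidHom.snd H H)
  let f : D →* H := (MonoidHom.fst H H).comp D.subtype
  have hf : (⊤ : Subgroup D).map f = ⊤ := by
    rw [eq_top_iff, ← hS, closure_le]
    exact fun s hs => ⟨⟨(s, s ^ m), mk_pow_mem_powerRelation m s, hm s hs⟩, mem_top _, rfl⟩
  rw [← hf, ← map_lowerCentralSeries] at hu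
  obtain ⟨d, hd, rfl⟩ := hu
  have hpow := mk_snd_eq_mk_fst_pow_of_mem_lowerCentralSeries inf_le_left hd
  exact mem_sup_of_normal_right.mpr
    ⟨d.1.2, d.2.2, _, QuotientGroup.eq.mp hpow, mul_inv_cancel_left _ _⟩

theorem pow_prod_mem_sup_lowerCentralSeries {S : Set H} (hS : closure S = ⊤) {K : Subgroup H}
    {m : ℕ} (hm : ∀ s ∈ S, s ^ m ∈ K) (h : H) (k : ℕ) :
    h ^ ∏ i ∈ Finset.range k, m ^ (i + 1) ∈ K ⊔ Γ[H][k] := by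
  induction k with
  | zero => exact mem_sup_right (mem_top _)
  | succ k ih =>
    obtain ⟨b, hb, u, hu, hbu⟩ := mem_sup_of_normal_right.mp ih
    have hcomm : Commute (b : H ⧸ Γ[H][k + 1]) u :=
      mem_center_iff.mp (mk_mem_center_of_mem_lowerCentralSeries hu) b
    have hmod : (b ^ m ^ (k + 1) * u ^ m ^ (k + 1))⁻¹ * (b * u) ^ m ^ (k + 1) ∈ Γ[H][k + 1] :=
      QuotientGroup.eq.mp (hcomm.mul_pow _).symm
    rw [Finset.prod_range_succ, pow_mul, ← hbu,
      ← mul_inv_cancel_left (b ^ m ^ (k + 1) * u ^ m ^ (k + 1)) ((b * u) ^ m ^ (k + 1))]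
    exact mul_mem (mul_mem (mem_sup_left (pow_mem hb _))
      (pow_mem_sup_lowerCentralSeries_succ hS hm hu)) (mem_sup_right hmod)

theorem pow_prod_mem_of_mem_closure [Group.IsNilpotent H] {S : Set H} {K : Subgroup H} {m : ℕ}
    (hm : ∀ s ∈ S, s ^ m ∈ K) {h : H} (hh : h ∈ closure S) :
    h ^ ∏ i ∈ Finset.range (Group.nilpotencyClass H), m ^ (i + 1) ∈ K := by
  have hpow := pow_prod_mem_sup_lowerCentralSeries (closure_closure_coe_preimage (k := S))
    (K := K.subgroupOf (closure S)) (m := m) (fun s hs => hm s hs) ⟨h, hh⟩ (Group.nilpotencyClass H)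
  obtain ⟨b, hb, u, hu, hbu⟩ := mem_sup_of_normal_right.mp hpow
  have hu_one : (u : H) = 1 := by
    have := map_mem_lowerCentralSeries (closure S).subtype hu
    rwa [Subgroup.lowerCentralSeries_nilpotencyClass, mem_bot] at this
  have hb_eq : (b : H) = h ^ ∏ i ∈ Finset.range (Group.nilpotencyClass H), m ^ (i + 1) := by
    simpa [hu_one] using congrArg Subtype.val hbu
  exact hb_eq ▸ hb

/-- The isolator of `K`: the elements of a nilpotent group that have a positive power in `K`. -/
def isolator [Group.IsNilpotent H] (K : Subgroup H) : Subgroup H where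
  carrier := {h | ∃ m, 0 < m ∧ h ^ m ∈ K}
  one_mem' := ⟨1, one_pos, by simp only [one_pow, one_mem]⟩
  inv_mem' := fun ⟨m, hm, h⟩ => ⟨m, hm, by simpa only [inv_pow, inv_mem_iff] using h⟩
  mul_mem' := fun {a b} ⟨m, hm, ha⟩ ⟨n, hn, hb⟩ => by
    refine ⟨_, Finset.prod_pos fun i _ => pow_pos (Nat.mul_pos hm hn) (i + 1),
      pow_prod_mem_of_mem_closure (S := {a, b}) ?_
        (mul_mem (subset_closure (Set.mem_insert a _)) (subset_closure (Or.inr rfl)))⟩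
    rintro s (rfl | rfl)
    · exact pow_mul s m n ▸ pow_mem ha n
    · exact mul_comm m n ▸ pow_mul s n m ▸ pow_mem hb m

theorem mem_isolator [Group.IsNilpotent H] {K : Subgroup H} {h : H} :
    h ∈ isolator K ↔ ∃ m, 0 < m ∧ h ^ m ∈ K :=
  Iff.rfl

section NilpotentSum

variable {K : Type*} [Field K]

/-- The sum of two one-parameter subgroups `x` and `y`, up to terms of the lower central series.
`nilpotentSum x y n` is multiplicative modulo its term with index `n + 1`, where the indices start
at `0`; the defect is homogeneous of degree `n + 2` in the next term. As in Richardson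
extrapolation, it cancels from `w t ^ 2 ^ (n + 2) * (w (2 * t))⁻¹`, and dividing `t` by
`2 ^ (n + 2) - 2` restores the derivative at `0`. -/
def nilpotentSum (x y : K → H) : ℕ → K → H
  | 0, t => x t * y t
  | n + 1, t => nilpotentSum x y n (t / (2 ^ (n + 2) - 2)) ^ 2 ^ (n + 2) *
      (nilpotentSum x y n (2 * (t / (2 ^ (n + 2) - 2))))⁻¹

theorem map_nilpotentSum (φ : H →* D) (x y : K → H) (n : ℕ) (t : K) :
    φ (nilpotentSum x y n t) = nilpotentSum (φ ∘ x) (φ ∘ y) n t := by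
  induction n generalizing t with
  | zero => exact map_mul φ _ _
  | succ n ih => simp only [nilpotentSum, map_mul, map_pow, map_inv, ih]

theorem nilpotentSum_comp_mul (x y : K → H) (n : ℕ) (a t : K) :
    nilpotentSum (fun s => x (a * s)) (fun s => y (a * s)) n t = nilpotentSum x y n (a * t) := by
  induction n generalizing t with
  | zero => rfl
  | succ n ih => simp only [nilpotentSum, ih, mul_div_assoc, mul_left_comm a 2]

theorem nilpotentSum_comp_ringHom {L : Type*} [Field L] (i : K →+* L) (x y : L → H) (n : ℕ)
    (t : K) : nilpotentSum (x ∘ i) (y ∘ i) n t = nilpotentSum x y n (i t) := by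
  induction n generalizing t with
  | zero => rfl
  | succ n ih => simp only [nilpotentSum, ih, map_mul, map_div₀, map_sub, map_pow, map_ofNat]

theorem nilpotentSum_mem {A : Subgroup H} {x y : K → H} (hx : ∀ t, x t ∈ A) (hy : ∀ t, y t ∈ A)
    (n : ℕ) (t : K) : nilpotentSum x y n t ∈ A := by
  induction n generalizing t with
  | zero => exact mul_mem (hx t) (hy t)
  | succ n ih => exact mul_mem (pow_mem (ih _) _) (inv_mem (ih _))

theorem continuous_nilpotentSum [TopologicalSpace K] [ContinuousMul K] [TopologicalSpace H]
    [IsTopologicalGroup H] {x y : K → H} (hx : Continuous x) (hy : Continuous y) (n : ℕ) :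
    Continuous (nilpotentSum x y n) := by
  induction n with
  | zero => exact hx.mul hy
  | succ n ih =>
    have hdiv : Continuous fun t : K => t / (2 ^ (n + 2) - 2) := continuous_id.div_const _
    exact ((ih.comp hdiv).pow _).mul (ih.comp (continuous_const.mul hdiv)).inv

/-- The curve `t ↦ (x t, x (m * t))` in the relation `b = a ^ m` modulo commutators. -/
def dilationPair (x : AddChar K H) (m : ℕ) : AddChar K (powerRelation H m) where
  toFun t := ⟨(x t, x (m * t)), by
    rw [← nsmul_eq_mul, AddChar.map_nsmul_eq_pow]
    exact mk_pow_mem_powerRelation m (x t)⟩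
  map_zero_eq_one' := Subtype.ext <| Prod.ext (AddChar.map_zero_eq_one x) <| by
    simp only [mul_zero, AddChar.map_zero_eq_one]; rfl
  map_add_eq_mul' s t := Subtype.ext <| Prod.ext (AddChar.map_add_eq_mul x s t) <| by
    simp only [mul_add, AddChar.map_add_eq_mul]; rfl

theorem nilpotentSum_dilationPair (x y : AddChar K H) (m n : ℕ) (t : K) :
    (nilpotentSum (dilationPair x m) (dilationPair y m) n t).1 =
      (nilpotentSum x y n t, nilpotentSum x y n (m * t)) :=
  Prod.ext (map_nilpotentSum ((MonoidHom.fst H H).comp (Subgroup.subtype _)) _ _ n t)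
    ((map_nilpotentSum ((MonoidHom.snd H H).comp (Subgroup.subtype _)) _ _ n t).trans
      (nilpotentSum_comp_mul x y n m t))

theorem exists_intCast_mul_eq_and_eq (s t : ℚ) :
    ∃ (r : ℚ) (a b : ℤ), s = a * r ∧ t = b * r := by
  have hs : (s.den : ℚ) ≠ 0 := mod_cast s.den_nz
  have ht : (t.den : ℚ) ≠ 0 := mod_cast t.den_nz
  refine ⟨(s.den * t.den : ℚ)⁻¹, s.num * t.den, t.num * s.den, ?_, ?_⟩
  · push_cast
    rw [mul_inv, mul_mul_mul_comm, mul_inv_cancel₀ ht, mul_one, ← div_eq_mul_inv, Rat.num_div_den]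
  · push_cast
    rw [mul_inv, mul_comm (s.den : ℚ)⁻¹, mul_mul_mul_comm, mul_inv_cancel₀ hs, mul_one,
      ← div_eq_mul_inv, Rat.num_div_den]

theorem commute_mk_of_mk_add_eq_mul {k : ℕ} {w : ℚ → H}
    (hw : ∀ s t, (w (s + t) : H ⧸ Γ[H][k]) = w s * w t) (s t : ℚ) :
    Commute (w s : H ⧸ Γ[H][k + 1]) (w t) := by
  let χ : AddChar ℚ (H ⧸ Γ[H][k]) :=
    { toFun := fun t => w t
      map_zero_eq_one' := by simpa using hw 0 0
      map_add_eq_mul' := hw }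
  obtain ⟨r, a, b, rfl, rfl⟩ := exists_intCast_mul_eq_and_eq s t
  have hpow (a : ℤ) : ∃ u : H ⧸ Γ[H][k + 1], (∀ q, Commute q u) ∧ w r ^ a * u = w (a * r) := by
    have h : ((w r ^ a : H) : H ⧸ Γ[H][k]) = w (a * r) := by
      rw [← zsmul_eq_mul]
      exact (AddChar.map_zsmul_eq_zpow χ a r).symm
    exact ⟨_, mem_center_iff.mp (mk_mem_center_of_mem_lowerCentralSeries (QuotientGroup.eq.mp h)),
      congrArg QuotientGroup.mk (mul_inv_cancel_left _ _)⟩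
  obtain ⟨u, hu, hua⟩ := hpow a
  obtain ⟨v, hv, hvb⟩ := hpow b
  rw [← hua, ← hvb]
  exact .mul_left (((Commute.refl _).zpow_zpow a b).mul_right (hv _)) (hu _).symm

theorem pow_mul_inv_eq_mul_of_defect {A : Type*} [CommGroup A] {a b c a' b' c' : A} {e : ℕ}
    (h : a' * b' * c'⁻¹ = (a * b * c⁻¹) ^ e) :
    c ^ e * c'⁻¹ = (a ^ e * a'⁻¹) * (b ^ e * b'⁻¹) := by
  simp only [← div_eq_mul_inv, div_pow, mul_pow] at h ⊢
  rw [div_mul_div_comm, div_eq_div_iff_mul_eq_mul]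
  rw [div_eq_div_iff_mul_eq_mul] at h
  rw [mul_comm, h]

theorem pow_mul_inv_eq_mul_of_defect_of_commute {w : K → H} (hcomm : ∀ s t, Commute (w s) (w t))
    {e : ℕ} {s t : K}
    (h : w (2 * s) * w (2 * t) * (w (2 * (s + t)))⁻¹ = (w s * w t * (w (s + t))⁻¹) ^ e) :
    w (s + t) ^ e * (w (2 * (s + t)))⁻¹ =
      (w s ^ e * (w (2 * s))⁻¹) * (w t ^ e * (w (2 * t))⁻¹) := by
  have : IsMulCommutative (closure (Set.range w)) := isMulCommutative_closure (by
    rintro _ ⟨s, rfl⟩ _ ⟨t, rfl⟩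
    exact hcomm s t)
  let v (t : K) : closure (Set.range w) := ⟨w t, subset_closure ⟨t, rfl⟩⟩
  have hv : v (2 * s) * v (2 * t) * (v (2 * (s + t)))⁻¹ = (v s * v t * (v (s + t))⁻¹) ^ e :=
    Subtype.ext h
  exact congrArg Subtype.val (pow_mul_inv_eq_mul_of_defect hv)

theorem mk_nilpotentSum_defect_two_mul {x y : AddChar K H} {n : ℕ} {s t : K}
    (h : let z := nilpotentSum (dilationPair x 2) (dilationPair y 2) n
      (z (s + t) : _ ⧸ Γ[powerRelation H 2][n + 1]) = z s * z t) :
    let w (t : K) : H ⧸ Γ[H][n + 2] := (nilpotentSum x y n t : H)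
    w (2 * s) * w (2 * t) * (w (2 * (s + t)))⁻¹ = (w s * w t * (w (s + t))⁻¹) ^ 2 ^ (n + 2) := by
  let z := nilpotentSum (dilationPair x 2) (dilationPair y 2) n
  have hmem : z s * z t * (z (s + t))⁻¹ ∈ Γ[powerRelation H 2][n + 1] := by
    rw [← QuotientGroup.eq_one_iff, QuotientGroup.mk_mul, QuotientGroup.mk_mul,
      QuotientGroup.mk_inv, h, mul_inv_cancel]
  have hpow := mk_snd_eq_mk_fst_pow_of_mem_lowerCentralSeries le_rfl hmem
  simpa only [z, Subgroup.coe_mul, Subgroup.coe_inv, Prod.fst_mul, Prod.snd_mul, Prod.fst_inv,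
    Prod.snd_inv, nilpotentSum_dilationPair, QuotientGroup.mk_mul, QuotientGroup.mk_inv,
    Nat.cast_ofNat] using hpow

theorem mk_nilpotentSum_add (x y : AddChar ℚ H) (n : ℕ) (s t : ℚ) :
    ((nilpotentSum x y n (s + t) : H) : H ⧸ Γ[H][n + 1]) =
      (nilpotentSum x y n s : H) * (nilpotentSum x y n t : H) := by
  induction n generalizing H s t with
  | zero =>
    have hcomm : Commute (x t : H ⧸ Γ[H][1]) (y s) :=
      (mem_center_iff.mp (mk_mem_center_of_mem_lowerCentralSeries (k := 0) (mem_top (y s))) _)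
    simp only [nilpotentSum, AddChar.map_add_eq_mul, QuotientGroup.mk_mul]
    exact hcomm.mul_mul_mul_comm _ _
  | succ n ih =>
    have h := pow_mul_inv_eq_mul_of_defect_of_commute (commute_mk_of_mk_add_eq_mul (ih x y))
      (mk_nilpotentSum_defect_two_mul (ih (dilationPair x 2) (dilationPair y 2)
        (s / (2 ^ (n + 2) - 2)) (t / (2 ^ (n + 2) - 2))))
    rw [← add_div] at h
    exact h

theorem nilpotentSum_add_rat [Group.IsNilpotent H] {n : ℕ} (hn : Group.nilpotencyClass H ≤ n + 1)
    (x y : AddChar ℚ H) (s t : ℚ) :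
    nilpotentSum x y n (s + t) = nilpotentSum x y n s * nilpotentSum x y n t := by
  have h := QuotientGroup.eq.mp (mk_nilpotentSum_add x y n s t)
  rw [Subgroup.lowerCentralSeries_eq_bot_iff_nilpotencyClass_le.mpr hn, mem_bot] at h
  exact inv_mul_eq_one.mp h

theorem nilpotentSum_add_real [Group.IsNilpotent H] [TopologicalSpace H] [IsTopologicalGroup H]
    [T2Space H] {n : ℕ} (hn : Group.nilpotencyClass H ≤ n + 1) {x y : AddChar ℝ H}
    (hx : Continuous x) (hy : Continuous y) (s t : ℝ) :
    nilpotentSum x y n (s + t) = nilpotentSum x y n s * nilpotentSum x y n t := by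
  have hcont : Continuous (nilpotentSum x y n) := continuous_nilpotentSum hx hy n
  have hrat (p q : ℚ) :
      nilpotentSum x y n (p + q) = nilpotentSum x y n p * nilpotentSum x y n q := by
    have h := nilpotentSum_add_rat hn (x.compAddMonoidHom (Rat.castHom ℝ))
      (y.compAddMonoidHom (Rat.castHom ℝ)) p q
    simpa only [AddChar.coe_compAddMonoidHom, AddMonoidHom.coe_coe, nilpotentSum_comp_ringHom,
      map_add, eq_ratCast] using h
  exact congrFun ((Rat.denseRange_cast.prodMap Rat.denseRange_cast).equalizer
    (hcont.comp (continuous_fst.add continuous_snd))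
    ((hcont.comp continuous_fst).mul (hcont.comp continuous_snd))
    (funext fun p : ℚ × ℚ => hrat p.1 p.2)) (s, t)

end NilpotentSum

end NilpotentGroups

section DerivativesAtOne

variable {𝕜 : Type*} [NontriviallyNormedField 𝕜]
  {E : Type*} [NormedAddCommGroup E] [NormedSpace 𝕜 E]
  {H : Type*} [TopologicalSpace H] {I : ModelWithCorners 𝕜 E H}
  {G : Type*} [Group G] [TopologicalSpace G] [ChartedSpace H G]
  {E' : Type*} [NormedAddCommGroup E'] [NormedSpace 𝕜 E']
  {H' : Type*} [TopologicalSpace H'] {I' : ModelWithCorners 𝕜 E' H'}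
  {M : Type*} [TopologicalSpace M] [ChartedSpace H' M]

theorem hasMFDerivAt_mul_one_one [LieGroup I 1 G] :
    HasMFDerivAt (I.prod I) I (fun p : G × G => p.1 * p.2) (1, 1)
      (ContinuousLinearMap.fst 𝕜 E E + ContinuousLinearMap.snd 𝕜 E E) := by
  have hdiff : MDifferentiableAt (I.prod I) I (fun p : G × G => p.1 * p.2) (1, 1) :=
    (contMDiff_mul I 1).mdifferentiableAt one_ne_zero
  have hleft : HasMFDerivAt I I (fun z : G => z * 1) 1 (ContinuousLinearMap.id 𝕜 E) :=
    (hasMFDerivAt_id 1).congr_of_eventuallyEq (.of_forall mul_one)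
  have hright : HasMFDerivAt I I (fun z : G => 1 * z) 1 (ContinuousLinearMap.id 𝕜 E) :=
    (hasMFDerivAt_id 1).congr_of_eventuallyEq (.of_forall one_mul)
  refine hdiff.hasMFDerivAt.congr_mfderiv (ContinuousLinearMap.ext fun v => ?_)
  exact (mfderiv_prod_eq_add_apply hdiff).trans
    (congrArg₂ (fun a b : E => a + b) (DFunLike.congr_fun hleft.mfderiv v.1)
      (DFunLike.congr_fun hright.mfderiv v.2))

/-- The map `f` takes the value `1` at `x` and has the derivative `f'` there. Fixing the value gives
all derivatives of such maps the same codomain, so that they can be added. -/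
def HasMFDerivToOne (I' : ModelWithCorners 𝕜 E' H') (I : ModelWithCorners 𝕜 E H) (f : M → G) (x : M)
    (f' : E' →L[𝕜] E) : Prop :=
  f x = 1 ∧ HasMFDerivAt I' I f x f'

namespace HasMFDerivToOne

variable {f g : M → G} {x : M} {f' g' : E' →L[𝕜] E}

theorem unique (hf : HasMFDerivToOne I' I f x f') (hg : HasMFDerivToOne I' I f x g') : f' = g' :=
  hasMFDerivAt_unique hf.2 hg.2

theorem const_one : HasMFDerivToOne I' I (fun _ : M => (1 : G)) x (0 : E' →L[𝕜] E) :=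
  ⟨rfl, hasMFDerivAt_const _ _⟩

theorem comp_mul_left {f : 𝕜 → G} {f' : 𝕜 →L[𝕜] E} (hf : HasMFDerivToOne 𝓘(𝕜, 𝕜) I f 0 f')
    (a : 𝕜) : HasMFDerivToOne 𝓘(𝕜, 𝕜) I (fun t => f (a * t)) 0 (a • f') := by
  refine ⟨(congrArg f (mul_zero a)).trans hf.1, ?_⟩
  have hmul : HasMFDerivAt 𝓘(𝕜, 𝕜) 𝓘(𝕜, 𝕜) (a * ·) 0 (a • ContinuousLinearMap.id 𝕜 𝕜) :=
    ((hasFDerivAt_id (0 : 𝕜)).const_smul a).hasMFDerivAt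
  have hf_mul : HasMFDerivAt 𝓘(𝕜, 𝕜) I f (a * 0) f' := by
    rw [mul_zero]
    exact hf.2
  exact (hf_mul.comp 0 hmul).congr_mfderiv (ContinuousLinearMap.ext fun (v : 𝕜) => map_smul f' a v)

variable [LieGroup I 1 G]

theorem mul (hf : HasMFDerivToOne I' I f x f') (hg : HasMFDerivToOne I' I g x g') :
    HasMFDerivToOne I' I (fun y => f y * g y) x (f' + g') := by
  have hmul : HasMFDerivAt (I.prod I) I (fun p : G × G => p.1 * p.2) (f x, g x)
      (ContinuousLinearMap.fst 𝕜 E E + ContinuousLinearMap.snd 𝕜 E E : E × E →L[𝕜] E) := by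
    rw [hf.1, hg.1]
    exact hasMFDerivAt_mul_one_one
  exact ⟨by simp only [hf.1, hg.1, mul_one], hmul.comp x (hf.2.prodMk hg.2)⟩

theorem inv (hf : HasMFDerivToOne I' I f x f') :
    HasMFDerivToOne I' I (fun y => (f y)⁻¹) x (-f') := by
  have hdiff : MDifferentiableAt I' I (fun y => (f y)⁻¹) x :=
    ((contMDiff_inv I 1).mdifferentiableAt one_ne_zero).comp x hf.2.mdifferentiableAt
  obtain ⟨g', hg'⟩ : ∃ g' : E' →L[𝕜] E, HasMFDerivToOne I' I (fun y => (f y)⁻¹) x g' :=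
    ⟨_, by simp only [hf.1, inv_one], hdiff.hasMFDerivAt⟩
  have hmul := hf.mul hg'
  simp only [mul_inv_cancel] at hmul
  exact neg_eq_of_add_eq_zero_right (hmul.unique const_one) ▸ hg'

theorem pow (hf : HasMFDerivToOne I' I f x f') (n : ℕ) :
    HasMFDerivToOne I' I (fun y => f y ^ n) x (n • f') := by
  induction n with
  | zero => simpa only [pow_zero, zero_smul] using const_one
  | succ n ih => simpa only [pow_succ, succ_nsmul] using ih.mul hf

theorem nilpotentSum [CharZero 𝕜] {x y : 𝕜 → G} {x' y' : 𝕜 →L[𝕜] E}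
    (hx : HasMFDerivToOne 𝓘(𝕜, 𝕜) I x 0 x') (hy : HasMFDerivToOne 𝓘(𝕜, 𝕜) I y 0 y') (n : ℕ) :
    HasMFDerivToOne 𝓘(𝕜, 𝕜) I (nilpotentSum x y n) 0 (x' + y') := by
  induction n with
  | zero => exact hx.mul hy
  | succ n ih =>
    set c : 𝕜 := 2 ^ (n + 2) - 2 with hc
    have hc_ne : c ≠ 0 := by
      have : (2 : ℕ) ^ (n + 2) ≠ 2 := by
        rw [pow_succ]; simp
      rw [hc, sub_ne_zero]
      exact mod_cast this
    have h := ((ih.comp_mul_left c⁻¹).pow (2 ^ (n + 2))).mul (ih.comp_mul_left (2 * c⁻¹)).inv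
    have hsmul (v : 𝕜 →L[𝕜] E) : (2 ^ (n + 2) : ℕ) • c⁻¹ • v + -((2 * c⁻¹) • v) = v := by
      match_scalars
      rw [hc] at hc_ne ⊢
      field_simp
      ring
    rw [hsmul] at h
    simp only [mul_assoc, inv_mul_eq_div] at h
    exact h

end HasMFDerivToOne

end DerivativesAtOne

section OneParameterSubgroups

open ContinuousLinearMap (toSpanSingleton)

variable {E : Type*} [NormedAddCommGroup E] [NormedSpace ℝ E]
  {H : Type*} [TopologicalSpace H] {I : ModelWithCorners ℝ E H}
  {G : Type*} [Group G] [TopologicalSpace G] [ChartedSpace H G]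
  {X : GroupLieAlgebra I G}

variable (I) in
/-- The curve `γ` is the one-parameter subgroup `t ↦ exp (t X)`, encoded as the integral curve
through `1` of the left-invariant vector field of `X`, as in `IsLieExp`. -/
def IsOneParameterSubgroup (X : GroupLieAlgebra I G) (γ : ℝ → G) : Prop :=
  γ 0 = 1 ∧ IsMIntegralCurve (I := I) γ (mulInvariantVectorField X)

theorem mulInvariantVectorField_one (X : GroupLieAlgebra I G) :
    (mulInvariantVectorField X (1 : G) : E) = X := by
  have h : HasMFDerivAt I I (fun g : G => 1 * g) 1 (ContinuousLinearMap.id ℝ E) :=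
    (hasMFDerivAt_id 1).congr_of_eventuallyEq (.of_forall one_mul)
  exact DFunLike.congr_fun h.mfderiv X

theorem IsOneParameterSubgroup.hasMFDerivToOne {γ : ℝ → G} (hγ : IsOneParameterSubgroup I X γ) :
    HasMFDerivToOne 𝓘(ℝ, ℝ) I γ 0 (toSpanSingleton ℝ (X : E)) := by
  have hfield : (mulInvariantVectorField X (γ 0) : E) = X := by
    rw [hγ.1]
    exact mulInvariantVectorField_one X
  exact ⟨hγ.1, (hγ.2 0).congr_mfderiv
    (ContinuousLinearMap.ext fun t : ℝ => congrArg (fun v : E => t • v) hfield)⟩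

section LeftTranslation

variable [LieGroup I 1 G]

theorem hasMFDerivAt_mul_left_comp_mul_left (a b : G) :
    HasMFDerivAt I I (fun g => a * b * g) 1
      ((mfderiv I I (fun g => a * g) b : E →L[ℝ] E).comp
        (mfderiv I I (fun g => b * g) 1 : E →L[ℝ] E)) := by
  have ha : HasMFDerivAt I I (fun g => a * g) (b * 1)
      (mfderiv I I (fun g => a * g) b : E →L[ℝ] E) := by
    rw [mul_one]
    exact mdifferentiableAt_mul_left.hasMFDerivAt
  exact (ha.comp 1 mdifferentiableAt_mul_left.hasMFDerivAt).congr_of_eventuallyEq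
    (.of_forall fun g => mul_assoc a b g)

theorem mfderiv_mul_left_mulInvariantVectorField (X : GroupLieAlgebra I G) (a b : G) :
    (mfderiv I I (fun g => a * g) b : E →L[ℝ] E) (mulInvariantVectorField X b : E) =
      (mulInvariantVectorField X (a * b) : E) :=
  (DFunLike.congr_fun (hasMFDerivAt_mul_left_comp_mul_left a b).mfderiv X).symm

theorem isMIntegralCurve_mul_left {γ : ℝ → G}
    (hγ : IsMIntegralCurve (I := I) γ (mulInvariantVectorField X)) (a : G) :
    IsMIntegralCurve (I := I) (fun t => a * γ t) (mulInvariantVectorField X) := fun t => by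
  refine (mdifferentiableAt_mul_left.hasMFDerivAt.comp t (hγ t)).congr_mfderiv
    (ContinuousLinearMap.ext fun s : ℝ => ?_)
  exact (map_smul (mfderiv I I (fun g => a * g) (γ t) : E →L[ℝ] E) s _).trans
    (congrArg (fun v : E => s • v) (mfderiv_mul_left_mulInvariantVectorField X a (γ t)))

theorem HasMFDerivToOne.isOneParameterSubgroup {γ : ℝ → G}
    (hγ : HasMFDerivToOne 𝓘(ℝ, ℝ) I γ 0 (toSpanSingleton ℝ (X : E)))
    (hadd : ∀ s t, γ (s + t) = γ s * γ t) : IsOneParameterSubgroup I X γ := by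
  refine ⟨hγ.1, fun t => ?_⟩
  have hshift : HasMFDerivAt 𝓘(ℝ, ℝ) 𝓘(ℝ, ℝ) (fun s : ℝ => s - t) t (.id ℝ ℝ) :=
    ((hasFDerivAt_id t).sub_const t).hasMFDerivAt
  have hγ_shift : HasMFDerivAt 𝓘(ℝ, ℝ) I γ (t - t) (toSpanSingleton ℝ (X : E)) := by
    rw [sub_self]
    exact hγ.2
  have hmul : HasMFDerivAt I I (fun g => γ t * g) (γ (t - t))
      (mfderiv I I (fun g => γ t * g) 1 : E →L[ℝ] E) := by
    rw [sub_self, hγ.1]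
    exact mdifferentiableAt_mul_left.hasMFDerivAt
  have hcurve : γ = fun s => γ t * γ (s - t) := funext fun s => by rw [← hadd, add_sub_cancel]
  have hcomp := hmul.comp t (hγ_shift.comp (f := fun s => s - t) t hshift)
  exact (hcomp.congr_of_eventuallyEq (.of_eq hcurve)).congr_mfderiv <|
    ContinuousLinearMap.ext fun s : ℝ =>
      map_smul (mfderiv I I (fun g => γ t * g) 1 : E →L[ℝ] E) s (X : E)

theorem isOneParameterSubgroup_zero :
    IsOneParameterSubgroup I (0 : GroupLieAlgebra I G) fun _ => 1 := by
  refine HasMFDerivToOne.isOneParameterSubgroup ?_ fun _ _ => (mul_one 1).symm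
  exact (ContinuousLinearMap.toSpanSingleton_zero ℝ (M₁ := E)) ▸ HasMFDerivToOne.const_one

end LeftTranslation

variable [LieGroup I ∞ G] [BoundarylessManifold I G] [T2Space G]

theorem eq_of_isMIntegralCurve_mulInvariantVectorField {γ γ' : ℝ → G}
    (hγ : IsMIntegralCurve (I := I) γ (mulInvariantVectorField X))
    (hγ' : IsMIntegralCurve (I := I) γ' (mulInvariantVectorField X)) (h : γ 0 = γ' 0) :
    γ = γ' := by
  have : LieGroup I (minSmoothness ℝ 3) G := by
    rw [minSmoothness_of_isRCLikeNormedField]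
    infer_instance
  have hfield : ContMDiff I I.tangent 1
      fun g => (⟨g, mulInvariantVectorField X g⟩ : TangentBundle I G) :=
    (contMDiff_mulInvariantVectorField X).of_le (one_le_two.trans le_minSmoothness)
  exact isMIntegralCurve_Ioo_eq_of_contMDiff_boundaryless hfield hγ hγ' h

namespace IsOneParameterSubgroup

variable {γ γ' : ℝ → G}

theorem unique (hγ : IsOneParameterSubgroup I X γ) (hγ' : IsOneParameterSubgroup I X γ') :
    γ = γ' :=
  eq_of_isMIntegralCurve_mulInvariantVectorField hγ.2 hγ'.2 (hγ.1.trans hγ'.1.symm)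

theorem map_add_eq_mul (hγ : IsOneParameterSubgroup I X γ) (s t : ℝ) :
    γ (s + t) = γ s * γ t := by
  have h := eq_of_isMIntegralCurve_mulInvariantVectorField (hγ.2.comp_add s)
    (isMIntegralCurve_mul_left hγ.2 (γ s)) (by simp [hγ.1])
  exact add_comm s t ▸ congrFun h t

/-- A one-parameter subgroup as an additive character of the real line. -/
def toAddChar (hγ : IsOneParameterSubgroup I X γ) : AddChar ℝ G where
  toFun := γ
  map_zero_eq_one' := hγ.1
  map_add_eq_mul' := hγ.map_add_eq_mul

theorem comp_mul_left (hγ : IsOneParameterSubgroup I X γ) (a : ℝ) :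
    IsOneParameterSubgroup I (a • X) fun t => γ (a * t) := by
  refine HasMFDerivToOne.isOneParameterSubgroup ?_ fun s t => by
    rw [mul_add, hγ.map_add_eq_mul]
  exact ContinuousLinearMap.toSpanSingleton_smul ℝ a (X : E) ▸ hγ.hasMFDerivToOne.comp_mul_left a

end IsOneParameterSubgroup

end OneParameterSubgroups

section RadicableHull

variable {E : Type*} [NormedAddCommGroup E] [NormedSpace ℝ E]
  {H : Type*} [TopologicalSpace H] {I : ModelWithCorners ℝ E H}
  {G : Type*} [Group G] [TopologicalSpace G] [ChartedSpace H G] [LieGroup I ∞ G]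
  [BoundarylessManifold I G] [T2Space G] {X Y : GroupLieAlgebra I G}

theorem IsOneParameterSubgroup.nilpotentSum [Group.IsNilpotent G] {n : ℕ}
    (hn : Group.nilpotencyClass G ≤ n + 1) {x y : ℝ → G} (hx : IsOneParameterSubgroup I X x)
    (hy : IsOneParameterSubgroup I Y y) :
    IsOneParameterSubgroup I (X + Y) (nilpotentSum x y n) := by
  have : IsTopologicalGroup G := topologicalGroup_of_lieGroup I ∞
  have hadd := nilpotentSum_add_real hn (x := hx.toAddChar) (y := hy.toAddChar) hx.2.continuous
    hy.2.continuous
  refine HasMFDerivToOne.isOneParameterSubgroup ?_ hadd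
  exact ContinuousLinearMap.toSpanSingleton_add ℝ (X : E) Y ▸
    hx.hasMFDerivToOne.nilpotentSum hy.hasMFDerivToOne n

variable [Group.IsNilpotent G] {N : Subgroup G}

theorem IsOneParameterSubgroup.apply_ratCast_mem_isolator {γ : ℝ → G}
    (hγ : IsOneParameterSubgroup I X γ) (hN : γ 1 ∈ N) (q : ℚ) : γ q ∈ isolator N := by
  refine mem_isolator.mpr ⟨q.den, q.den_pos, ?_⟩
  have hpow : γ q ^ q.den = γ 1 ^ q.num := by
    have h : q.den • (q : ℝ) = q.num • (1 : ℝ) := by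
      rw [nsmul_eq_mul, zsmul_one]
      exact_mod_cast Rat.den_mul_eq_num q
    exact (hγ.toAddChar.map_nsmul_eq_pow q.den q).symm.trans
      ((congrArg γ h).trans (hγ.toAddChar.map_zsmul_eq_zpow q.num 1))
  exact hpow ▸ N.zpow_mem hN q.num

theorem exists_isOneParameterSubgroup_of_mem_rationalLieAlgebra
    (hX : X ∈ rationalLieAlgebra I N) :
    ∃ γ, IsOneParameterSubgroup I X γ ∧ ∀ q : ℚ, γ q ∈ isolator N := by
  let _ := lieRatModule I G
  change X ∈ Submodule.span ℚ (lieLog I N) at hX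
  induction hX using Submodule.span_induction with
  | mem X hX =>
    obtain ⟨g, hg, γ, hγ_zero, hγ, rfl⟩ := hX
    have hγ : IsOneParameterSubgroup I X γ := ⟨hγ_zero, hγ⟩
    exact ⟨γ, hγ, hγ.apply_ratCast_mem_isolator hg⟩
  | zero => exact ⟨_, isOneParameterSubgroup_zero, fun _ => one_mem _⟩
  | add X Y _ _ hX hY =>
    obtain ⟨x, hx, hxN⟩ := hX
    obtain ⟨y, hy, hyN⟩ := hY
    refine ⟨_, hx.nilpotentSum (Nat.le_succ (Group.nilpotencyClass G)) hy, fun q => ?_⟩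
    exact nilpotentSum_comp_ringHom (Rat.castHom ℝ) x y _ q ▸ nilpotentSum_mem hxN hyN _ q
  | smul a X _ hX =>
    obtain ⟨γ, hγ, hγN⟩ := hX
    exact ⟨_, hγ.comp_mul_left a, fun q => by exact_mod_cast hγN (a * q)⟩

theorem radicableHull_subset_isolator (N : Subgroup G) : radicableHull I N ⊆ isolator N := by
  rintro g ⟨X, hX, γ, hγ_zero, hγ, rfl⟩
  obtain ⟨γ', hγ', hγ'N⟩ := exists_isOneParameterSubgroup_of_mem_rationalLieAlgebra hX
  rw [IsOneParameterSubgroup.unique ⟨hγ_zero, hγ⟩ hγ']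
  exact_mod_cast hγ'N 1

end RadicableHull

section Finiteness

section LocalInjectivity

variable {𝕜 : Type*} [RCLike 𝕜] {E : Type*} [NormedAddCommGroup E] [NormedSpace 𝕜 E]
  {H : Type*} [TopologicalSpace H] {I : ModelWithCorners 𝕜 E H}

theorem exists_mem_nhds_injOn_of_hasStrictFDerivAt {F : Type*} [NormedAddCommGroup F]
    [NormedSpace 𝕜 F] {f : E → F} {f' : E ≃L[𝕜] F} {x : E}
    (hf : HasStrictFDerivAt f (f' : E →L[𝕜] F) x) : ∃ U ∈ nhds x, Set.InjOn f U := by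
  obtain ⟨U, hxU, hU, happrox⟩ := hf.approximates_deriv_on_open_nhds
  exact ⟨U, hU.mem_nhds hxU, happrox.injOn (f'.subsingleton_or_nnnorm_symm_pos.imp id fun hpos =>
    NNReal.half_lt_self (inv_pos.mpr hpos).ne')⟩

theorem exists_mem_nhds_injOn_of_hasMFDerivAt {M : Type*} [TopologicalSpace M] [ChartedSpace H M]
    {E' : Type*} [NormedAddCommGroup E'] [NormedSpace 𝕜 E'] {H' : Type*} [TopologicalSpace H']
    {I' : ModelWithCorners 𝕜 E' H'} {M' : Type*} [TopologicalSpace M'] [ChartedSpace H' M']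
    {f : M → M'} {x : M} (hx : I.IsInteriorPoint x) (hf : ContMDiffAt I I' 1 f x) {f' : E ≃L[𝕜] E'}
    (hf' : HasMFDerivAt I I' f x (f' : E →L[𝕜] E')) : ∃ U ∈ nhds x, Set.InjOn f U := by
  let φ := extChartAt I x
  have hrange : Set.range I ∈ nhds (φ x) := range_mem_nhds_isInteriorPoint hx
  have hsmooth : ContDiffAt 𝕜 1 (writtenInExtChartAt I I' x f) (φ x) :=
    (contMDiffAt_iff.mp hf).2.contDiffAt hrange
  have hderiv : HasFDerivAt (writtenInExtChartAt I I' x f) (f' : E →L[𝕜] E') (φ x) :=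
    hf'.2.hasFDerivAt hrange
  obtain ⟨U, hU, hinj⟩ := exists_mem_nhds_injOn_of_hasStrictFDerivAt
    (hsmooth.hasStrictFDerivAt' hderiv one_ne_zero)
  refine ⟨_, Filter.inter_mem ((continuousAt_extChartAt x).preimage_mem_nhds hU)
    (extChartAt_source_mem_nhds (I := I) x), ?_⟩
  rintro y ⟨hyU, hy⟩ z ⟨hzU, hz⟩ hyz
  refine φ.injOn hy hz (hinj hyU hzU ?_)
  simp only [writtenInExtChartAt, Function.comp_apply, φ.left_inv hy, φ.left_inv hz, hyz, φ]

theorem eventually_pow_eq_one_imp_eq_one {G : Type*} [Group G] [TopologicalSpace G]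
    [ChartedSpace H G] [LieGroup I 1 G] (h1 : I.IsInteriorPoint (1 : G)) {m : ℕ} (hm : m ≠ 0) :
    ∀ᶠ u in nhds (1 : G), u ^ m = 1 → u = 1 := by
  let e : E ≃L[𝕜] E :=
    ContinuousLinearEquiv.smulLeft (Units.mk0 (m : 𝕜) (Nat.cast_ne_zero.mpr hm))
  have he : (e : E →L[𝕜] E) = m • ContinuousLinearMap.id 𝕜 E :=
    ContinuousLinearMap.ext fun v => Nat.cast_smul_eq_nsmul 𝕜 m v
  have hderiv : HasMFDerivAt I I (fun u : G => u ^ m) 1 (e : E →L[𝕜] E) :=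
    he ▸ (HasMFDerivToOne.pow (f := id) ⟨rfl, hasMFDerivAt_id (1 : G)⟩ m).2
  obtain ⟨U, hU, hinj⟩ :=
    exists_mem_nhds_injOn_of_hasMFDerivAt h1 (contMDiff_pow (n := 1) m).contMDiffAt hderiv
  filter_upwards [hU] with u hu hpow
  exact hinj hu (mem_of_mem_nhds hU) (hpow.trans (one_pow m).symm)

end LocalInjectivity

theorem isDiscrete_of_isDiscrete_preimage {X Y : Type*} [TopologicalSpace X] [TopologicalSpace Y]
    {f : X → Y} (hf : IsOpenMap f) {s : Set Y} (hs : IsDiscrete (f ⁻¹' s))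
    (hrange : s ⊆ Set.range f) : IsDiscrete s := by
  refine .of_nhdsWithin fun y hy => ?_
  obtain ⟨x, rfl⟩ := hrange hy
  calc nhdsWithin (f x) s
      ≤ Filter.map f (nhds x) ⊓ Filter.principal s := inf_le_inf_right _ (hf.nhds_le x)
    _ = Filter.map f (nhdsWithin x (f ⁻¹' s)) := by
      rw [← Filter.push_pull, Filter.comap_principal, nhdsWithin]
    _ = pure (f x) := by rw [hs.nhdsWithin x hy, Filter.map_pure]

theorem preimage_nilProj_image {G : Type*} [Group G] {N L : Subgroup G} (hNL : N ≤ L) :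
    nilProj N ⁻¹' (nilProj N '' L) = L := by
  refine (Set.subset_preimage_image _ _).antisymm' ?_
  rintro g ⟨h, hh, hgh⟩
  have hmem : g * h⁻¹ ∈ N := QuotientGroup.rightRel_apply.mp (Quotient.exact hgh)
  exact inv_mul_cancel_right g h ▸ mul_mem (hNL hmem) hh

theorem nilProj_eq_nilProj_one_iff {G : Type*} [Group G] {N : Subgroup G} {g : G} :
    nilProj N g = nilProj N 1 ↔ g ∈ N := by
  rw [nilProj, nilProj, Quotient.eq, QuotientGroup.rightRel_apply, one_mul, inv_mem_iff]

theorem map_mem_of_semiconj_nilProj {G : Type*} [Group G] {N : Subgroup G} {δ : G →* G}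
    {f : Nilmanifold N → Nilmanifold N} (hf : Function.Semiconj (nilProj N) δ f) {n : G}
    (hn : n ∈ N) : δ n ∈ N := by
  rw [← nilProj_eq_nilProj_one_iff, hf n, nilProj_eq_nilProj_one_iff.mpr hn, ← hf 1, map_one]

variable {G : Type*} [Group G] [TopologicalSpace G] [IsTopologicalGroup G] {N L : Subgroup G}

theorem discreteTopology_of_pow_mem [DiscreteTopology N] {m : ℕ}
    (htors : ∀ᶠ u in nhds (1 : G), u ^ m = 1 → u = 1) (hL : ∀ h ∈ L, h ^ m ∈ N) :
    DiscreteTopology L := by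
  have hN_nhds : nhdsWithin 1 (N : Set G) = pure 1 := IsDiscrete.nhdsWithin ⟨‹_›⟩ 1 N.one_mem
  have hN : ∀ᶠ u in nhds (1 : G), u ∈ N → u = 1 :=
    eventually_nhdsWithin_iff.mp (hN_nhds ▸ Filter.eventually_pure.mpr rfl)
  have hpow : Filter.Tendsto (fun u : G => u ^ m) (nhds 1) (nhds 1) := by
    simpa only [one_pow] using (continuous_pow m).tendsto (1 : G)
  refine discreteTopology_of_isOpen_singleton_one (isOpen_singleton_iff_nhds_eq_pure _ |>.mpr ?_)
  refine le_antisymm (Filter.le_pure_iff.mpr ?_) (pure_le_nhds _)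
  filter_upwards [continuous_subtype_val.tendsto (1 : L) (htors.and (hpow hN))] with h ⟨h_tors, hhN⟩
  exact Subtype.ext (h_tors (hhN (hL h h.2)))

theorem IsCocompactLattice.finite_nilProj_image [T2Space G] [DiscreteTopology L]
    (hN : IsCocompactLattice N) (hNL : N ≤ L) : (nilProj N '' (L : Set G)).Finite := by
  have := hN.compact
  have hpre : nilProj N ⁻¹' (nilProj N '' L) = L := preimage_nilProj_image hNL
  have hclosed : IsClosed (nilProj N '' (L : Set G)) := by
    refine (isQuotientMap_quotient_mk' (s := QuotientGroup.rightRel N)).isClosed_preimage.mp ?_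
    exact hpre.symm ▸ Subgroup.isClosed_of_discrete
  have hopen : IsOpenMap (nilProj N) := isOpenMap_quotient_mk'_mul (Γ := N) (T := G)
  exact hclosed.isCompact.finite (isDiscrete_of_isDiscrete_preimage hopen
    (hpre.symm ▸ ⟨inferInstance⟩) (Set.image_subset_range _ _))

theorem mem_ePer_of_finite {X : Type*} {f : X → X} {A : Set X} (hA : A.Finite)
    (hf : Set.MapsTo f A A) {x : X} (hx : x ∈ A) : x ∈ ePer f := by
  obtain ⟨i, j, hij, h⟩ := hA.exists_lt_map_eq_of_forall_mem (f := fun k : ℕ => f^[k + 1] x)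
    fun k => hf.iterate (k + 1) hx
  refine ⟨i + 1, i.succ_pos, j - i, Nat.sub_pos_of_lt hij, ?_⟩
  change f^[j - i] (f^[i + 1] x) = f^[i + 1] x
  rw [← Function.iterate_add_apply, ← add_assoc, Nat.sub_add_cancel hij.le, h]

end Finiteness

theorem mainTheorem5_general
    {E : Type*} [NormedAddCommGroup E] [NormedSpace ℝ E]
    {H : Type*} [TopologicalSpace H] {I : ModelWithCorners ℝ E H}
    {G : Type*} [Group G] [TopologicalSpace G] [ChartedSpace H G] [LieGroup I ∞ G]
    [BoundarylessManifold I G] [T2Space G] [Group.IsNilpotent G]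
    {N : Subgroup G} (hN : IsCocompactLattice N)
    {δ : G →* G} {f : Nilmanifold N → Nilmanifold N} (hf : Function.Semiconj (nilProj N) δ f) :
    nilProj N '' radicableHull I N ⊆ ePer f := by
  have : IsTopologicalGroup G := topologicalGroup_of_lieGroup I ∞
  have := hN.discrete
  rintro _ ⟨g, hg, rfl⟩
  obtain ⟨m, hm, hgm⟩ := mem_isolator.mp (radicableHull_subset_isolator N hg)
  let R : Set G := {h | h ^ m ∈ N}
  have hNR : N ≤ Subgroup.closure R := fun n hn => Subgroup.subset_closure (N.pow_mem hn m)
  have : DiscreteTopology (Subgroup.closure R) := discreteTopology_of_pow_mem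
    (eventually_pow_eq_one_imp_eq_one (I := I) BoundarylessManifold.isInteriorPoint
      (Finset.prod_pos fun i _ => pow_pos hm (i + 1)).ne')
    fun h hh => pow_prod_mem_of_mem_closure (S := R) (fun s hs => hs) hh
  have hfinite : (nilProj N '' R).Finite :=
    (hN.finite_nilProj_image hNR).subset (Set.image_mono Subgroup.subset_closure)
  refine mem_ePer_of_finite hfinite ?_ ⟨g, hgm, rfl⟩
  rintro _ ⟨h, hh, rfl⟩
  have hδh : δ h ^ m ∈ N := map_pow δ h m ▸ map_mem_of_semiconj_nilProj hf hh
  exact ⟨δ h, hδh, hf h⟩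

theorem mainTheorem5
    {E : Type*} [NormedAddCommGroup E] [NormedSpace ℝ E] [FiniteDimensional ℝ E]
    {G : Type*} [Group G] [TopologicalSpace G] [ChartedSpace E G] [LieGroup 𝓘(ℝ, E) ∞ G]
    [T2Space G] [SimplyConnectedSpace G] [Group.IsNilpotent G]
    (N : Subgroup G) (hN : IsCocompactLattice N)
    (δ : G ≃ₜ* G) (hδ : ∀ n ∈ N, δ n ∈ N) :
    nilProj N '' radicableHull 𝓘(ℝ, E) N ⊆ ePer (nilEndomorphism N δ hδ) :=
  mainTheorem5_general hN (δ := (δ : G →* G)) fun _ => rfl
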